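/- **Language.** Work in a two-sorted first-order language. Terms of the numeric sort $\omega$ (numeric expressions) are built from parameters, $0$, successor and symbols for primitive recursive functions; $n$ is one distinguished parameter, the free parameter. Terms of the sort $\iota$ are built from ordinary variables, schematic variables $x:\omega\to\iota$ applied to numeric expressions, and function symbols (defined or uninterpreted) with arguments of both sorts. Formula schemata are built from atoms (with defined or uninterpreted predicate symbols) by $\neg,\wedge,\vee,\to$ and by $\forall,\exists$ over $\iota$. An equational theory $\mathcal E$ is a set of rules $\hat f(\bar t)\equiv e$ ($e$ a term) or $\hat P(\bar t)\equiv e$ ($e$ a formula schema), with $\hat f,\hat P$ defined symbols and $\bar t$ free of defined symbols. Structures interpret $\omega$ by $\mathbb N$; a model of $\mathcal E$ satisfies all rules for all values of variables and parameters; $\mathcal E\models t\equiv t'$ means that $t,t'$ agree in all models of $\mathcal E$; and *valid* means true in all models of $\mathcal E$ for all values of variables and parameters. A sequent $\Delta\vdash\Gamma$ is a pair of finite multisets of formula schemata. $\mathbf{LKE}$ is the usual sequent calculus $\mathbf{LK}$ with the rule $\mathcal E$: from $S(t)$ infer $S(t')$ if $\mathcal E\models t\equiv t'$. The eigenvariable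 condition is on $\forall{:}r$ and $\exists{:}l$, and an eigenvariable $x(k)$ has to differ from the other occurrences $x(k')$ for all values of the parameters. **The calculus.** A component pair $\nu:\pi$ has a basecase $\pi$, a sequent or a closed sequent $[\pi]$, and a stepcase $\nu$, either $\top$ or a sequent with a superscript (a numeric expression) on its turnstile. An open component group is a multiset of pairs; a closed one is $[\,]:[\pi]$ or $[S[n\backslash\alpha]]:[S[n\backslash 0]]$ for a sequent schema $S$ and a numeric expression $\alpha$. A collection is a finite set of groups. The inferences of $\mathcal S i\mathbf{LK}$ act on one open group, starting from the empty collection ($G$ denotes the other pairs of the group, and the superscript of a stepcase is written after it): * add a new group $\top:A\vdash A$, or add the pair $\top:A\vdash A$ to a group; * $\top:[\pi]$ becomes $(A\vdash^{f}A):[\pi]$, for any superscript $f$; * contract two equal pairs, with stepcase $\top$ or with closed basecase; replace $\nu:[\pi]$ by the two pairs $\top:[\pi]$ and $\nu:[\pi]$; * apply a unary or binary $\mathbf{LKE}$-rule to unclosed basecases with stepcase $\top$, or to stepcases (with a common superscript, which is kept) over the same closed basecase; * close a basecase: $\top:\pi$ becomes $\top:[\pi]$; * $\circlearrowright$: $\top:[S[n\backslash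 0]]$ becomes $S[n\backslash n][\bar x\backslash\bar t]:[S[n\backslash 0]]$ with superscript $n+1$; * $\curvearrowright$: if the collection contains a closed group $[T[n\backslash h]]:[\delta]$, then $\top:[\pi]$ becomes $T[n\backslash g][\bar y\backslash\bar t]:[\pi]$ with any superscript $f$, where $g,h$ are primitive recursive in $n$; * a group consisting of the single pair $\top:[\pi]$ is closed to $[\,]:[\pi]$; a group consisting of the single pair $\nu:[S[n\backslash 0]]$ with superscript $\alpha$ and $\nu=S[n\backslash\alpha]$ is closed to $[S[n\backslash\alpha]]:[S[n\backslash 0]]$. A collection $C$ is *provable with leading component $C_0$* if all groups of $C$ are closed and $C$ has a derivation in which $C_0$ is the group closed last. Put $\mathcal I(\Delta\vdash\Gamma)=\bigwedge\Delta\to\bigvee\Gamma$. Let $C$ consist of closed groups $C_0,\dots,C_m$ with basecases $[\pi_i]$, and for $C_i=[S_i[n\backslash\alpha_i]]:[S_i[n\backslash 0]]$ let $S_i$ be its schema. If $C_0=[\,]:[\pi_0]$, put $\mathcal I_{\mathcal S i\mathbf{LK}}(C)=\mathcal I(\pi_0)$; otherwise $$\mathcal I_{\mathcal S i\mathbf{LK}}(C)=\Big(\bigwedge_{i}\mathcal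 I(\pi_i)\wedge\forall x\bigwedge_{i}\big(\mathcal I(S_i[n\backslash x])\to\mathcal I(S_i[n\backslash x+1])\big)\Big)\to\forall x\,\mathcal I(S_0[n\backslash x]),$$ where $x$ ranges over $\omega$ and the second conjunction is over the groups that have a schema. **Theorem (Soundness of the $\mathcal S i\mathbf{LK}$-calculus).** Let $\mathcal E$ be an equational theory and $C$ a collection. 1. If $C$ is $\mathcal S i\mathbf{LK}$-provable with leading component $C_0$, then $C$ is valid, that is, $\mathcal I_{\mathcal S i\mathbf{LK}}(C)$ is valid. 2. Call a proof *tied* if closing a basecase fixes a schema that the inferences $\circlearrowright$ and the closure of that group must use as $S$, and if in every $\curvearrowright$, with $T,g,h$ and the closed group $[T[n\backslash h]]:[\delta]$ as above, $\delta=T[n\backslash 0]$ and, for all values of the parameters, the value of $g$ is $0$ or a value of $h$ at some value of $n$ (this holds for every $g$ if $h=n+1$). If $C$ has a tied proof with leading component $C_0$, then $C_0\in C$ and every component of $C$, in particular the leading one, is valid: $\mathcal I(\pi)$ is valid for each group $[\,]:[\pi]$ of $C$; for each group $[S[n\backslash\alpha]]:[S[n\backslash 0]]$ of $C$, $\mathcal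 I(S[n\backslash 0])$ and $\forall n\,\mathcal I(S[n\backslash\alpha])$ are valid; and if $\alpha=n+1$, then $\forall n\,\mathcal I(S)$ is valid. -/

import Mathlib

universe u

namespace SiLK

/-! ### The two-sorted schematic language -/

/-- Signature of the sort of individuals `ι`. Function and predicate symbols take arguments of
both sorts: `fnNum`, `prNum` count the arguments of the numeric sort `ω`, and `fnInd`, `prInd` those
of sort `ι`. `fnDef` and `prDef` single out the defined symbols (those written with a hat); the
other symbols are uninterpreted. -/
structure Signature : Type (u + 1) where
  Fn : Type u
  fnNum : Fn → ℕ
  fnInd : Fn → ℕ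
  fnDef : Fn → Prop
  Pr : Type u
  prNum : Pr → ℕ
  prInd : Pr → ℕ
  prDef : Pr → Prop

/-- Numeric expressions (terms of sort `ω`): parameters, `0`, successor, and symbols for primitive
recursive functions. -/
inductive NumExp : Type where
  | param (p : ℕ) : NumExp
  | zero : NumExp
  | succ (k : NumExp) : NumExp
  | prim {r : ℕ} (f : List.Vector ℕ r → ℕ) (hf : Nat.Primrec' f) (args : Fin r → NumExp) : NumExp

/-- The index of the free parameter `n`; the other parameters only serve as numeric variables. -/
def freeParam : ℕ := 0

/-- The free parameter `n` as a numeric expression. -/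
def NumExp.n : NumExp := .param freeParam

/-- The value of a numeric expression; every closed one evaluates to a numeral. -/
def NumExp.eval (e : ℕ → ℕ) : NumExp → ℕ
  | .param p => e p
  | .zero => 0
  | .succ k => k.eval e + 1
  | .prim f _ args => f (List.Vector.ofFn fun i => (args i).eval e)

/-- `k[p \ w]`: replace the parameter `p` by the numeric expression `w`. -/
def NumExp.nsubst (p : ℕ) (w : NumExp) : NumExp → NumExp
  | .param q => if q = p then w else .param q
  | .zero => .zero
  | .succ k => .succ (nsubst p w k)
  | .prim f hf args => .prim f hf fun i => nsubst p w (args i)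

/-- Terms of sort `ι` under `k` binders. `bvar i` is the variable bound by the `i`-th binder,
counted from the outermost one; `fvar a` is an ordinary free variable; `sch x j` is the schematic
variable `x : ω → ι` at the index `j`. -/
inductive ITerm (L : Signature.{u}) (k : ℕ) : Type u where
  | bvar (i : Fin k) : ITerm L k
  | fvar (a : ℕ) : ITerm L k
  | sch (x : ℕ) (j : NumExp) : ITerm L k
  | fn (f : L.Fn) (ks : Fin (L.fnNum f) → NumExp) (ts : Fin (L.fnInd f) → ITerm L k) : ITerm L k

/-- Formula schemata under `k` binders; `Fml L 0` is the type of formula schemata proper. -/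
inductive Fml (L : Signature.{u}) : ℕ → Type u where
  | atom {k : ℕ} (P : L.Pr) (ks : Fin (L.prNum P) → NumExp) (ts : Fin (L.prInd P) → ITerm L k) :
      Fml L k
  | neg {k : ℕ} (A : Fml L k) : Fml L k
  | and {k : ℕ} (A B : Fml L k) : Fml L k
  | or {k : ℕ} (A B : Fml L k) : Fml L k
  | imp {k : ℕ} (A B : Fml L k) : Fml L k
  | all {k : ℕ} (A : Fml L (k + 1)) : Fml L k
  | ex {k : ℕ} (A : Fml L (k + 1)) : Fml L k

variable {L : Signature.{u}}

/-! ### Substitutions -/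

/-- A term without bound variables, seen under `k` binders. -/
def ITerm.lift {k : ℕ} : ITerm L 0 → ITerm L k
  | .bvar i => i.elim0
  | .fvar a => .fvar a
  | .sch x j => .sch x j
  | .fn f ks ts => .fn f ks fun i => (ts i).lift

/-- `t[p \ w]` for a parameter `p` and a numeric expression `w`. -/
def ITerm.nsubst {k : ℕ} (p : ℕ) (w : NumExp) : ITerm L k → ITerm L k
  | .bvar i => .bvar i
  | .fvar a => .fvar a
  | .sch x j => .sch x (NumExp.nsubst p w j)
  | .fn f ks ts => .fn f (fun i => NumExp.nsubst p w (ks i)) fun i => (ts i).nsubst p w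

/-- Substitution of terms for free variables: an ordinary variable `a` is replaced by the term
`ind a`; a schematic variable `x : ω → ι` by the function `λ p. t` where `sch x = (p, t)`, that is,
`x(j)` becomes `t[p \ j]`. -/
structure Subst (L : Signature.{u}) : Type u where
  ind : ℕ → ITerm L 0
  sch : ℕ → ℕ × ITerm L 0

/-- Apply a substitution to a term. -/
def ITerm.subst {k : ℕ} (σ : Subst L) : ITerm L k → ITerm L k
  | .bvar i => .bvar i
  | .fvar a => (σ.ind a).lift
  | .sch x j => ((σ.sch x).2.nsubst (σ.sch x).1 j).lift
  | .fn f ks ts => .fn f ks fun i => (ts i).subst σ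

/-- Replace the variable of the outermost binder by the term `t`. -/
def ITerm.inst {k : ℕ} (t : ITerm L 0) : ITerm L (k + 1) → ITerm L k
  | .bvar i => Fin.cases t.lift (fun i' => .bvar i') i
  | .fvar a => .fvar a
  | .sch x j => .sch x j
  | .fn f ks ts => .fn f ks fun i => inst t (ts i)

/-- `A[p \ w]` for a parameter `p` and a numeric expression `w`. -/
def Fml.nsubst (p : ℕ) (w : NumExp) : {k : ℕ} → Fml L k → Fml L k
  | _, .atom P ks ts => .atom P (fun i => NumExp.nsubst p w (ks i)) fun i => (ts i).nsubst p w
  | _, .neg A => .neg (A.nsubst p w)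
  | _, .and A B => .and (A.nsubst p w) (B.nsubst p w)
  | _, .or A B => .or (A.nsubst p w) (B.nsubst p w)
  | _, .imp A B => .imp (A.nsubst p w) (B.nsubst p w)
  | _, .all A => .all (A.nsubst p w)
  | _, .ex A => .ex (A.nsubst p w)

/-- Apply a substitution to a formula schema. -/
def Fml.subst (σ : Subst L) : {k : ℕ} → Fml L k → Fml L k
  | _, .atom P ks ts => .atom P ks fun i => (ts i).subst σ
  | _, .neg A => .neg (A.subst σ)
  | _, .and A B => .and (A.subst σ) (B.subst σ)
  | _, .or A B => .or (A.subst σ) (B.subst σ)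
  | _, .imp A B => .imp (A.subst σ) (B.subst σ)
  | _, .all A => .all (A.subst σ)
  | _, .ex A => .ex (A.subst σ)

/-- Replace the variable of the outermost binder by the term `t`; for `A : Fml L 1`, the body of
`∀ x. A` or `∃ x. A`, this is `A[x \ t]`. -/
def Fml.inst (t : ITerm L 0) : {k : ℕ} → Fml L (k + 1) → Fml L k
  | _, .atom P ks ts => .atom P ks fun i => ITerm.inst t (ts i)
  | _, .neg A => .neg (A.inst t)
  | _, .and A B => .and (A.inst t) (B.inst t)
  | _, .or A B => .or (A.inst t) (B.inst t)
  | _, .imp A B => .imp (A.inst t) (B.inst t)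
  | _, .all A => .all (A.inst t)
  | _, .ex A => .ex (A.inst t)

/-! ### Eigenvariables -/

/-- A free variable of sort `ι`: an ordinary one, or a schematic variable at an index. -/
inductive EVar : Type where
  | ind (a : ℕ) : EVar
  | sch (x : ℕ) (j : NumExp) : EVar

/-- A free variable as a term. -/
def EVar.term : EVar → ITerm L 0
  | .ind a => .fvar a
  | .sch x j => .sch x j

/-- The variable does not occur in the term. A schematic variable `x(j)` counts as occurring in
`x(j')` as soon as the two indices agree for some values of the parameters. -/
def ITerm.Avoids {k : ℕ} (z : EVar) : ITerm L k → Prop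
  | .bvar _ => True
  | .fvar a => z ≠ .ind a
  | .sch x j' => ∀ j, z = .sch x j → ∀ e : ℕ → ℕ, j.eval e ≠ j'.eval e
  | .fn _ _ ts => ∀ i, (ts i).Avoids z

/-- The variable does not occur in the formula schema. -/
def Fml.Avoids (z : EVar) : {k : ℕ} → Fml L k → Prop
  | _, .atom _ _ ts => ∀ i, (ts i).Avoids z
  | _, .neg A => A.Avoids z
  | _, .and A B => A.Avoids z ∧ B.Avoids z
  | _, .or A B => A.Avoids z ∧ B.Avoids z
  | _, .imp A B => A.Avoids z ∧ B.Avoids z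
  | _, .all A => A.Avoids z
  | _, .ex A => A.Avoids z

/-! ### Semantics -/

/-- A structure. The numeric sort is always interpreted by `ℕ`. -/
structure Model (L : Signature.{u}) : Type (u + 1) where
  D : Type u
  nonempty : Nonempty D
  fn : (f : L.Fn) → (Fin (L.fnNum f) → ℕ) → (Fin (L.fnInd f) → D) → D
  pr : (P : L.Pr) → (Fin (L.prNum P) → ℕ) → (Fin (L.prInd P) → D) → Prop

/-- Values of the parameters, of the ordinary variables and of the schematic variables. -/
structure Val (M : Model L) : Type u where
  num : ℕ → ℕ
  ind : ℕ → M.D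
  sch : ℕ → ℕ → M.D

/-- The value of a term; `b` gives the values of the bound variables. -/
def ITerm.eval {M : Model L} (v : Val M) {k : ℕ} (b : Fin k → M.D) : ITerm L k → M.D
  | .bvar i => b i
  | .fvar a => v.ind a
  | .sch x j => v.sch x (j.eval v.num)
  | .fn f ks ts => M.fn f (fun i => (ks i).eval v.num) fun i => (ts i).eval v b

/-- Truth of a formula schema; quantifiers range over the sort `ι`. -/
def Fml.Holds {M : Model L} (v : Val M) : {k : ℕ} → (Fin k → M.D) → Fml L k → Prop
  | _, b, .atom P ks ts => M.pr P (fun i => (ks i).eval v.num) fun i => (ts i).eval v b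
  | _, b, .neg A => ¬ A.Holds v b
  | _, b, .and A B => A.Holds v b ∧ B.Holds v b
  | _, b, .or A B => A.Holds v b ∨ B.Holds v b
  | _, b, .imp A B => A.Holds v b → B.Holds v b
  | _, b, .all A => ∀ d : M.D, A.Holds v (Fin.snoc b d : Fin _ → M.D)
  | _, b, .ex A => ∃ d : M.D, A.Holds v (Fin.snoc b d : Fin _ → M.D)

/-! ### Equational theories -/

/-- The term contains no defined function symbol. -/
def ITerm.NoDefined {k : ℕ} : ITerm L k → Prop
  | .bvar _ => True
  | .fvar _ => True
  | .sch _ _ => True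
  | .fn f _ ts => ¬ L.fnDef f ∧ ∀ i, (ts i).NoDefined

/-- An equational theory: rules `f̂(t̄) ≡ E` with `f̂` a defined function symbol and `E` a term, and
rules `P̂(t̄) ≡ E` with `P̂` a defined predicate symbol and `E` a formula schema, where `t̄` contains
no defined symbols. Convergence of the rules is not required. -/
structure EqTheory (L : Signature.{u}) : Type u where
  termRule : ITerm L 0 → ITerm L 0 → Prop
  fmlRule : Fml L 0 → Fml L 0 → Prop
  termRule_shape : ∀ l r, termRule l r →
    ∃ f ks ts, L.fnDef f ∧ l = .fn f ks ts ∧ ∀ i, (ts i).NoDefined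
  fmlRule_shape : ∀ l r, fmlRule l r →
    ∃ P ks ts, L.prDef P ∧ l = .atom P ks ts ∧ ∀ i, (ts i).NoDefined

/-- `M` is a model of the theory: both sides of every rule agree for all values of the variables
and parameters. -/
def Model.Satisfies (M : Model L) (E : EqTheory L) : Prop :=
  (∀ l r, E.termRule l r → ∀ v : Val M, l.eval v Fin.elim0 = r.eval v Fin.elim0) ∧
  (∀ l r, E.fmlRule l r → ∀ v : Val M, l.Holds v Fin.elim0 ↔ r.Holds v Fin.elim0)

/-- `E ⊨ A ≡ A'`. -/
def EqTheory.Equiv (E : EqTheory L) (A A' : Fml L 0) : Prop :=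
  ∀ M : Model L, M.Satisfies E → ∀ v : Val M, A.Holds v Fin.elim0 ↔ A'.Holds v Fin.elim0

/-! ### Sequents and the calculus LKE -/

/-- A schematic sequent `ant ⊢ suc`. -/
structure Seq (L : Signature.{u}) : Type u where
  ant : Multiset (Fml L 0)
  suc : Multiset (Fml L 0)

/-- `S[n \ w]`. -/
def Seq.atN (S : Seq L) (w : NumExp) : Seq L :=
  ⟨S.ant.map (Fml.nsubst freeParam w), S.suc.map (Fml.nsubst freeParam w)⟩

/-- `S[x̄ \ t̄]`. -/
def Seq.subst (S : Seq L) (σ : Subst L) : Seq L :=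
  ⟨S.ant.map (Fml.subst σ), S.suc.map (Fml.subst σ)⟩

/-- The variable does not occur in the sequent. -/
def Seq.Avoids (z : EVar) (S : Seq L) : Prop :=
  (∀ A ∈ S.ant, A.Avoids z) ∧ ∀ A ∈ S.suc, A.Avoids z

/-- The axiom `A ⊢ A`. -/
def Seq.ax (A : Fml L 0) : Seq L := ⟨{A}, {A}⟩

/-- The unary inferences of LKE: premise, conclusion. In the last two rules (the `E`-inference), the
replacement of a term or a subformula of `A` by one that equals it modulo `E` turns `A` into an `A'`
with `E ⊨ A ≡ A'`. -/
inductive Rule1 (E : EqTheory L) : Seq L → Seq L → Prop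
  | andL (A B Γ Δ) : Rule1 E ⟨A ::ₘ B ::ₘ Γ, Δ⟩ ⟨A.and B ::ₘ Γ, Δ⟩
  | orR (A B Γ Δ) : Rule1 E ⟨Γ, A ::ₘ B ::ₘ Δ⟩ ⟨Γ, A.or B ::ₘ Δ⟩
  | negL (A Γ Δ) : Rule1 E ⟨Γ, A ::ₘ Δ⟩ ⟨A.neg ::ₘ Γ, Δ⟩
  | negR (A Γ Δ) : Rule1 E ⟨A ::ₘ Γ, Δ⟩ ⟨Γ, A.neg ::ₘ Δ⟩
  | impR (A B Γ Δ) : Rule1 E ⟨A ::ₘ Γ, B ::ₘ Δ⟩ ⟨Γ, A.imp B ::ₘ Δ⟩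
  | contrL (A Γ Δ) : Rule1 E ⟨A ::ₘ A ::ₘ Γ, Δ⟩ ⟨A ::ₘ Γ, Δ⟩
  | contrR (A Γ Δ) : Rule1 E ⟨Γ, A ::ₘ A ::ₘ Δ⟩ ⟨Γ, A ::ₘ Δ⟩
  | weakL (A Γ Δ) : Rule1 E ⟨Γ, Δ⟩ ⟨A ::ₘ Γ, Δ⟩
  | weakR (A Γ Δ) : Rule1 E ⟨Γ, Δ⟩ ⟨Γ, A ::ₘ Δ⟩
  | allL (A : Fml L 1) (t : ITerm L 0) (Γ Δ) : Rule1 E ⟨A.inst t ::ₘ Γ, Δ⟩ ⟨A.all ::ₘ Γ, Δ⟩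
  | allR (A : Fml L 1) (z : EVar) (Γ Δ) (hz : Seq.Avoids z ⟨Γ, A.all ::ₘ Δ⟩) :
      Rule1 E ⟨Γ, A.inst z.term ::ₘ Δ⟩ ⟨Γ, A.all ::ₘ Δ⟩
  | exL (A : Fml L 1) (z : EVar) (Γ Δ) (hz : Seq.Avoids z ⟨A.ex ::ₘ Γ, Δ⟩) :
      Rule1 E ⟨A.inst z.term ::ₘ Γ, Δ⟩ ⟨A.ex ::ₘ Γ, Δ⟩
  | exR (A : Fml L 1) (t : ITerm L 0) (Γ Δ) : Rule1 E ⟨Γ, A.inst t ::ₘ Δ⟩ ⟨Γ, A.ex ::ₘ Δ⟩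
  | eqL (A A' Γ Δ) (h : E.Equiv A A') : Rule1 E ⟨A ::ₘ Γ, Δ⟩ ⟨A' ::ₘ Γ, Δ⟩
  | eqR (A A' Γ Δ) (h : E.Equiv A A') : Rule1 E ⟨Γ, A ::ₘ Δ⟩ ⟨Γ, A' ::ₘ Δ⟩

/-- The binary inferences of LKE: left premise, right premise, conclusion. -/
inductive Rule2 : Seq L → Seq L → Seq L → Prop
  | andR (A B Γ Δ Θ Λ) : Rule2 ⟨Γ, A ::ₘ Δ⟩ ⟨Θ, B ::ₘ Λ⟩ ⟨Γ + Θ, A.and B ::ₘ (Δ + Λ)⟩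
  | orL (A B Γ Δ Θ Λ) : Rule2 ⟨A ::ₘ Γ, Δ⟩ ⟨B ::ₘ Θ, Λ⟩ ⟨A.or B ::ₘ (Γ + Θ), Δ + Λ⟩
  | impL (A B Γ Δ Θ Λ) : Rule2 ⟨Γ, A ::ₘ Δ⟩ ⟨B ::ₘ Θ, Λ⟩ ⟨A.imp B ::ₘ (Γ + Θ), Δ + Λ⟩
  | cut (A Γ Δ Θ Λ) : Rule2 ⟨Γ, A ::ₘ Δ⟩ ⟨A ::ₘ Θ, Λ⟩ ⟨Γ + Θ, Δ + Λ⟩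

/-! ### Component pairs, groups and collections -/

/-- A stepcase of an open group: `⊤`, or a sequent `T` with superscript `α` on its turnstile. -/
inductive Step (L : Signature.{u}) : Type u where
  | top : Step L
  | sq (α : NumExp) (T : Seq L) : Step L

/-- A basecase: a sequent `π`, or a closed sequent `[π]`. A closed basecase also records the sequent
schema `S` that is to be proved with it as the instance at `0`. -/
inductive Base (L : Signature.{u}) : Type u where
  | unclosed (π : Seq L) : Base L
  | closed (π S : Seq L) : Base L

/-- A component pair `stepcase : basecase`. -/
structure CPair (L : Signature.{u}) : Type u where
  step : Step L
  base : Base L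

/-- A component group: an open one (a multiset of component pairs), a group `[ ] : [π]` closed as an
LKE-proof, or a group `[S[n \ α]] : [S[n \ 0]]` closed as a schema. -/
inductive Group (L : Signature.{u}) : Type u where
  | opened (Γ : Multiset (CPair L)) : Group L
  | lke (π : Seq L) : Group L
  | sc (S : Seq L) (α : NumExp) : Group L

/-- The group is closed. -/
def Group.IsClosed : Group L → Prop
  | .opened _ => False
  | .lke _ => True
  | .sc _ _ => True

noncomputable instance : DecidableEq (Group L) := Classical.decEq _

/-- A component collection is a finite set of component groups. -/
abbrev Collection (L : Signature.{u}) : Type u := Finset (Group L)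

/-! ### The SiLK-calculus -/

/-- Two readings of the calculus. In `literal` the schematic sequents `Π ⊢ Δ` and `Λ ⊢ Γ` and the
functions `g` and `h` of the closure and linking rules may be chosen anew, and at will, at each
inference. In `tied` the loop and the closure of a group have to use the schema recorded when its
basecase was closed, and a link may only call instances of the closed group that the group
provides: the instance at `0`, or one at a value of `h`. -/
inductive Mode : Type where
  | literal : Mode
  | tied : Mode

/-- The inferences that turn an open group into an open group, in the context `ctx` of the other
component groups. -/
inductive GroupRule (E : EqTheory L) (m : Mode) (ctx : Collection L) :
    Multiset (CPair L) → Multiset (CPair L) → Prop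
  | axR (A Γ) : GroupRule E m ctx Γ (⟨.top, .unclosed (.ax A)⟩ ::ₘ Γ)
  | axL (A α π S Γ) : GroupRule E m ctx
      (⟨.top, .closed π S⟩ ::ₘ Γ) (⟨.sq α (.ax A), .closed π S⟩ ::ₘ Γ)
  | contrR (β Γ) : GroupRule E m ctx (⟨.top, β⟩ ::ₘ ⟨.top, β⟩ ::ₘ Γ) (⟨.top, β⟩ ::ₘ Γ)
  | contrL (ν π S Γ) : GroupRule E m ctx
      (⟨ν, .closed π S⟩ ::ₘ ⟨ν, .closed π S⟩ ::ₘ Γ) (⟨ν, .closed π S⟩ ::ₘ Γ)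
  | branch (ν π S Γ) : GroupRule E m ctx
      (⟨ν, .closed π S⟩ ::ₘ Γ) (⟨.top, .closed π S⟩ ::ₘ ⟨ν, .closed π S⟩ ::ₘ Γ)
  | closeBase (π S Γ) : GroupRule E m ctx
      (⟨.top, .unclosed π⟩ ::ₘ Γ) (⟨.top, .closed π S⟩ ::ₘ Γ)
  | step1 (α T T' π S Γ) (h : Rule1 E T T') : GroupRule E m ctx
      (⟨.sq α T, .closed π S⟩ ::ₘ Γ) (⟨.sq α T', .closed π S⟩ ::ₘ Γ)
  | step2 (α T₁ T₂ T' π S Γ) (h : Rule2 T₁ T₂ T') : GroupRule E m ctx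
      (⟨.sq α T₁, .closed π S⟩ ::ₘ ⟨.sq α T₂, .closed π S⟩ ::ₘ Γ)
      (⟨.sq α T', .closed π S⟩ ::ₘ Γ)
  | base1 (π π' Γ) (h : Rule1 E π π') : GroupRule E m ctx
      (⟨.top, .unclosed π⟩ ::ₘ Γ) (⟨.top, .unclosed π'⟩ ::ₘ Γ)
  | base2 (π₁ π₂ π' Γ) (h : Rule2 π₁ π₂ π') : GroupRule E m ctx
      (⟨.top, .unclosed π₁⟩ ::ₘ ⟨.top, .unclosed π₂⟩ ::ₘ Γ) (⟨.top, .unclosed π'⟩ ::ₘ Γ)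
  /-- The loop: from the closed basecase `[S[n \ 0]]` to the stepcase `S[n \ n][x̄ \ t̄]` with
  superscript `n + 1`. -/
  | loop (π S S' Γ) (σ : Subst L) (hπ : π = S'.atN .zero) (hm : m = .tied → S' = S) :
      GroupRule E m ctx (⟨.top, .closed π S⟩ ::ₘ Γ)
        (⟨.sq (.succ .n) ((S'.atN .n).subst σ), .closed π S⟩ ::ₘ Γ)
  /-- The link to a closed group `[T[n \ h]] : [δ]` of the context, with `T` standing for `Λ ⊢ Γ`:
  it introduces the stepcase `T[n \ g][ȳ \ t̄]` with any superscript `f`. -/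
  | link (π S Γ) (S₁ : Seq L) (α₁ : NumExp) (T : Seq L) (f g h : NumExp) (σ : Subst L)
      (hctx : Group.sc S₁ α₁ ∈ ctx) (hT : S₁.atN α₁ = T.atN h)
      (hm : m = .tied → S₁.atN .zero = T.atN .zero ∧ ∀ e : ℕ → ℕ, g.eval e = 0 ∨
        ∃ i : ℕ, g.eval e = h.eval (Function.update e freeParam i)) :
      GroupRule E m ctx (⟨.top, .closed π S⟩ ::ₘ Γ)
        (⟨.sq f ((T.atN g).subst σ), .closed π S⟩ ::ₘ Γ)

/-- The inferences that close a group; the group has to consist of a single component pair. -/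
inductive CloseRule (m : Mode) : Multiset (CPair L) → Group L → Prop
  | closeLKE (π S) : CloseRule m {⟨.top, .closed π S⟩} (.lke π)
  | closeSC (α T π S S') (hT : T = S'.atN α) (hπ : π = S'.atN .zero) (hm : m = .tied → S' = S) :
      CloseRule m {⟨.sq α T, .closed π S⟩} (.sc S' α)

/-- `Deriv E m C ℓ`: the collection `C` is derivable from the empty collection, and `ℓ` is the group
that was closed last (`none` as long as no group has been closed). -/
inductive Deriv (E : EqTheory L) (m : Mode) : Collection L → Option (Group L) → Prop
  | start : Deriv E m ∅ none
  | newGroup (A C ℓ) : Deriv E m C ℓ →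
      Deriv E m (insert (.opened {⟨.top, .unclosed (.ax A)⟩}) C) ℓ
  | groupRule (Γ Γ' C ℓ) (h : GroupRule E m C Γ Γ') : Deriv E m (insert (.opened Γ) C) ℓ →
      Deriv E m (insert (.opened Γ') C) ℓ
  | close (Γ G C ℓ) (h : CloseRule m Γ G) : Deriv E m (insert (.opened Γ) C) ℓ →
      Deriv E m (insert G C) (some G)

/-- `C` has a SiLK-proof (so all its groups are closed) in which `G₀` is the leading component, that
is, the component group closed last. -/
def Provable (E : EqTheory L) (m : Mode) (C : Collection L) (G₀ : Group L) : Prop :=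
  (∀ G ∈ C, G.IsClosed) ∧ Deriv E m C (some G₀)

/-! ### Evaluation of closed component collections -/

/-- Formulas built from formula schemata, with truth constants and with quantification over the
free parameter `n` (`allNum φ` is `∀ n. φ`, equivalently `∀ x. φ[n \ x]`). -/
inductive EFml (L : Signature.{u}) : Type u where
  | fml (A : Fml L 0) : EFml L
  | top : EFml L
  | bot : EFml L
  | and (φ ψ : EFml L) : EFml L
  | or (φ ψ : EFml L) : EFml L
  | imp (φ ψ : EFml L) : EFml L
  | allNum (φ : EFml L) : EFml L

/-- Truth of an evaluation formula. -/
def EFml.Holds {M : Model L} : EFml L → Val M → Prop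
  | .fml A, v => A.Holds v Fin.elim0
  | .top, _ => True
  | .bot, _ => False
  | .and φ ψ, v => φ.Holds v ∧ ψ.Holds v
  | .or φ ψ, v => φ.Holds v ∨ ψ.Holds v
  | .imp φ ψ, v => φ.Holds v → ψ.Holds v
  | .allNum φ, v => ∀ i : ℕ, φ.Holds { v with num := Function.update v.num freeParam i }

/-- Validity: truth in all models of the equational theory, for all values of the free variables and
parameters. -/
def EFml.Valid (E : EqTheory L) (φ : EFml L) : Prop :=
  ∀ M : Model L, M.Satisfies E → ∀ v : Val M, φ.Holds v

/-- Finite conjunction. -/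
def EFml.bigAnd (l : List (EFml L)) : EFml L := l.foldr .and .top

/-- Finite disjunction. -/
def EFml.bigOr (l : List (EFml L)) : EFml L := l.foldr .or .bot

/-- The evaluation `I(Δ ⊢ Γ) = ⋀ Δ → ⋁ Γ` of a sequent. -/
noncomputable def Seq.interp (S : Seq L) : EFml L :=
  .imp (.bigAnd (S.ant.toList.map .fml)) (.bigOr (S.suc.toList.map .fml))

/-- `I(π)` for the basecase `[π]` of a closed group. -/
noncomputable def Group.baseInterp : Group L → EFml L
  | .opened _ => .top
  | .lke π => π.interp
  | .sc S _ => (S.atN .zero).interp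

/-- `I(ν[n \ n]) → I(ν[n \ n + 1])` for the schema `ν` of a closed group; trivial if the stepcase is
`[ ]`. -/
noncomputable def Group.stepInterp : Group L → EFml L
  | .opened _ => .top
  | .lke _ => .top
  | .sc S _ => .imp (S.atN .n).interp (S.atN (.succ .n)).interp

/-- The evaluation `I_SiLK` of the closed component collection `C` with leading component `G₀`. -/
noncomputable def evalSiLK (C : Collection L) : Group L → EFml L
  | .opened _ => .top
  | .lke π => π.interp
  | .sc S _ =>
      .imp (.and (.bigAnd (C.toList.map Group.baseInterp))
        (.allNum (.bigAnd (C.toList.map Group.stepInterp))))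
        (.allNum (S.atN .n).interp)

end SiLK

namespace SiLK

variable {L : Signature.{u}} {M : Model L}

/-! ### Substitution lemmas -/

/-! The two readings hold for different reasons. In the literal one, a leading schema evaluates to
an instance of induction on `n`: its own basecase and step are among the conjuncts of the premise,
so membership in the collection suffices (`evalSiLK_sc_valid`). For a leading group without
stepcase, basecases are built by LKE inferences alone, and no stepcase ever feeds into a basecase,
so they are valid.

In the tied reading an invariant is carried through the derivation (`Deriv.sound`). Fix the values
of the parameters. A stepcase with superscript `n + 1` holds there for all values of the variables,
provided that the schema recorded in its basecase does; with any other superscript it holds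
outright. The loop is the only inference that calls the schema, and it sets the superscript to `n +
1`; links call only instances already known to be valid (`stepSound_of_link`). When a group is
closed at `n + 1`, the invariant is an induction step and yields the whole schema
(`Seq.valid_of_stepSound`).

Fixing the parameters but not the variables is essential: the induction hypothesis is available only
at the current `n`, whereas eigenvariables and the substitutions in loops need it for all values of
the variables (`Rule1.holdsAt`). -/

theorem NumExp.eval_nsubst (e : ℕ → ℕ) (p : ℕ) (w k : NumExp) :
    (NumExp.nsubst p w k).eval e = k.eval (Function.update e p (w.eval e)) := by
  induction k with
  | param q =>
    by_cases h : q = p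
    · subst h; simp [NumExp.nsubst, NumExp.eval]
    · simp [NumExp.nsubst, NumExp.eval, h]
  | zero => rfl
  | succ k ih => simp [NumExp.nsubst, NumExp.eval, ih]
  | prim f hf args ih => simp [NumExp.nsubst, NumExp.eval, ih]

/-- The valuation with the parameter `p` set to `i`. -/
def Val.setNum (v : Val M) (p i : ℕ) : Val M := { v with num := Function.update v.num p i }

theorem ITerm.eval_lift (v : Val M) {k : ℕ} (b : Fin k → M.D) (t : ITerm L 0) :
    (t.lift : ITerm L k).eval v b = t.eval v Fin.elim0 := by
  induction t with
  | bvar i => exact i.elim0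
  | fvar a => rfl
  | sch x j => rfl
  | fn f ks ts ih => simp [ITerm.lift, ITerm.eval, ih]

theorem ITerm.eval_nsubst (v : Val M) (p : ℕ) (w : NumExp) {k : ℕ} (b : Fin k → M.D)
    (t : ITerm L k) : (t.nsubst p w).eval v b = t.eval (v.setNum p (w.eval v.num)) b := by
  induction t with
  | bvar i => rfl
  | fvar a => rfl
  | sch x j => simp [ITerm.nsubst, ITerm.eval, NumExp.eval_nsubst, Val.setNum]
  | fn f ks ts ih => simp [ITerm.nsubst, ITerm.eval, NumExp.eval_nsubst, ih, Val.setNum]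

/-- The valuation that evaluates the free variables as the terms put for them by `σ`. -/
def Val.subst (v : Val M) (σ : Subst L) : Val M where
  num := v.num
  ind a := (σ.ind a).eval v Fin.elim0
  sch x j := (σ.sch x).2.eval (v.setNum (σ.sch x).1 j) Fin.elim0

theorem ITerm.eval_subst (v : Val M) (σ : Subst L) {k : ℕ} (b : Fin k → M.D) (t : ITerm L k) :
    (t.subst σ).eval v b = t.eval (v.subst σ) b := by
  induction t with
  | bvar i => rfl
  | fvar a => simp [ITerm.subst, ITerm.eval, ITerm.eval_lift, Val.subst]
  | sch x j => simp [ITerm.subst, ITerm.eval, ITerm.eval_lift, ITerm.eval_nsubst, Val.subst]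
  | fn f ks ts ih => simp [ITerm.subst, ITerm.eval, ih]; rfl

theorem ITerm.eval_inst (v : Val M) (t : ITerm L 0) {k : ℕ} (b : Fin k → M.D)
    (s : ITerm L (k + 1)) :
    (ITerm.inst t s).eval v b
      = s.eval v (Fin.cons (t.eval v Fin.elim0) b : Fin (k + 1) → M.D) := by
  induction s with
  | bvar i =>
    refine Fin.cases ?_ (fun i => ?_) i
    · simp [ITerm.inst, ITerm.eval, ITerm.eval_lift]
    · simp [ITerm.inst, ITerm.eval]
  | fvar a => rfl
  | sch x j => rfl
  | fn f ks ts ih => simp [ITerm.inst, ITerm.eval, ih]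

theorem Fml.holds_nsubst (v : Val M) (p : ℕ) (w : NumExp) {k : ℕ} (b : Fin k → M.D)
    (A : Fml L k) : (A.nsubst p w).Holds v b ↔ A.Holds (v.setNum p (w.eval v.num)) b := by
  induction A with
  | atom P ks ts =>
    simp [Fml.nsubst, Fml.Holds, NumExp.eval_nsubst, ITerm.eval_nsubst, Val.setNum]
  | _ => simp [Fml.nsubst, Fml.Holds, *]

theorem Fml.holds_subst (v : Val M) (σ : Subst L) {k : ℕ} (b : Fin k → M.D) (A : Fml L k) :
    (A.subst σ).Holds v b ↔ A.Holds (v.subst σ) b := by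
  induction A with
  | atom P ks ts => simp [Fml.subst, Fml.Holds, ITerm.eval_subst]; rfl
  | _ => simp [Fml.subst, Fml.Holds, *]

/-- Instantiation removes the outermost binder, at the front of the tuple of bound values, while
quantifiers append at its end. The statement is for every depth so that the quantifier cases can use
that `Fin.cons` and `Fin.snoc` commute. -/
theorem Fml.holds_inst_cons (v : Val M) (t : ITerm L 0) :
    ∀ {k : ℕ} (A : Fml L (k + 1)) (b : Fin k → M.D), (A.inst t).Holds v b ↔
      A.Holds v (Fin.cons (t.eval v Fin.elim0) b : Fin (k + 1) → M.D)
  | _, .atom P ks ts, b => by simp [Fml.inst, Fml.Holds, ITerm.eval_inst]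
  | _, .neg A, b => by simp only [Fml.inst, Fml.Holds, holds_inst_cons v t A]
  | _, .and A B, b => by
    simp only [Fml.inst, Fml.Holds, holds_inst_cons v t A, holds_inst_cons v t B]
  | _, .or A B, b => by
    simp only [Fml.inst, Fml.Holds, holds_inst_cons v t A, holds_inst_cons v t B]
  | _, .imp A B, b => by
    simp only [Fml.inst, Fml.Holds, holds_inst_cons v t A, holds_inst_cons v t B]
  | _, .all A, b => by
    simp only [Fml.inst, Fml.Holds, holds_inst_cons v t A, Fin.cons_snoc_eq_snoc_cons]
  | _, .ex A, b => by
    simp only [Fml.inst, Fml.Holds, holds_inst_cons v t A, Fin.cons_snoc_eq_snoc_cons]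

theorem Fml.holds_inst (v : Val M) (t : ITerm L 0) (A : Fml L 1) :
    (A.inst t).Holds v Fin.elim0 ↔
      A.Holds v (Fin.snoc Fin.elim0 (t.eval v Fin.elim0) : Fin 1 → M.D) := by
  have h : (Fin.snoc Fin.elim0 (t.eval v Fin.elim0) : Fin 1 → M.D)
      = Fin.cons (t.eval v Fin.elim0) Fin.elim0 := by
    funext i
    exact Fin.cases rfl (fun i => i.elim0) i
  rw [h]
  exact Fml.holds_inst_cons v t A Fin.elim0

/-! ### Eigenvariables -/

/-- The valuation with the free variable `z` set to `d`. -/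
noncomputable def Val.setVar (v : Val M) (d : M.D) : EVar → Val M
  | .ind a => { v with ind := Function.update v.ind a d }
  | .sch x j => { v with
      sch := Function.update v.sch x (Function.update (v.sch x) (j.eval v.num) d) }

@[simp] theorem Val.setVar_num (v : Val M) (d : M.D) (z : EVar) : (v.setVar d z).num = v.num := by
  cases z <;> rfl

theorem EVar.eval_term (v : Val M) (d : M.D) (z : EVar) :
    z.term.eval (v.setVar d z) Fin.elim0 = d := by
  cases z <;> simp [EVar.term, ITerm.eval, Val.setVar]

theorem ITerm.eval_setVar (v : Val M) (d : M.D) (z : EVar) {k : ℕ} (b : Fin k → M.D)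
    (t : ITerm L k) (h : t.Avoids z) : t.eval (v.setVar d z) b = t.eval v b := by
  induction t with
  | bvar i => rfl
  | fvar a =>
    cases z with
    | ind a' =>
      have : a ≠ a' := fun h' => h (by rw [h'])
      simp [ITerm.eval, Val.setVar, this]
    | sch x j => rfl
  | sch x j =>
    cases z with
    | ind a => rfl
    | sch x' j' =>
      by_cases hx : x = x'
      · subst hx
        -- Even for the same schematic variable, the two indices differ at the current parameters,
        -- so the update misses this occurrence.
        have := h j' rfl v.num
        simp [ITerm.eval, Val.setVar, this.symm]
      · simp [ITerm.eval, Val.setVar, hx]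
  | fn f ks ts ih =>
    simp only [ITerm.eval, Val.setVar_num]
    congr 1
    funext i
    exact ih i (h i)

theorem Fml.holds_setVar (v : Val M) (d : M.D) (z : EVar) {k : ℕ} (b : Fin k → M.D)
    (A : Fml L k) (h : A.Avoids z) : A.Holds (v.setVar d z) b ↔ A.Holds v b := by
  induction A with
  | atom P ks ts =>
    simp only [Fml.Holds, Val.setVar_num]
    rw [show (fun i => (ts i).eval (v.setVar d z) b) = fun i => (ts i).eval v b from
      funext fun i => ITerm.eval_setVar v d z b (ts i) (h i)]
  | neg A ih => exact not_congr (ih b h)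
  | and A B ihA ihB => exact and_congr (ihA b h.1) (ihB b h.2)
  | or A B ihA ihB => exact or_congr (ihA b h.1) (ihB b h.2)
  | imp A B ihA ihB => exact imp_congr (ihA b h.1) (ihB b h.2)
  | all A ih => exact forall_congr' fun d => ih _ h
  | ex A ih => exact exists_congr fun d => ih _ h

/-- This turns an eigenvariable into an arbitrary element `d`: it is the semantic content of both
eigenvariable rules. -/
theorem Fml.holds_inst_eigen (v : Val M) (d : M.D) (z : EVar) (A : Fml L 1) (h : A.Avoids z) :
    (A.inst z.term).Holds (v.setVar d z) Fin.elim0 ↔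
      A.Holds v (Fin.snoc Fin.elim0 d : Fin 1 → M.D) := by
  rw [Fml.holds_inst, EVar.eval_term, Fml.holds_setVar v d z _ A h]

/-! ### Truth of sequents -/

/-- Truth of a sequent. -/
def Seq.Holds (v : Val M) (S : Seq L) : Prop :=
  (∀ A ∈ S.ant, A.Holds v Fin.elim0) → ∃ A ∈ S.suc, A.Holds v Fin.elim0

theorem EFml.holds_bigAnd (v : Val M) (l : List (EFml L)) :
    (EFml.bigAnd l).Holds v ↔ ∀ φ ∈ l, φ.Holds v := by
  induction l with
  | nil => simp [EFml.bigAnd, EFml.Holds]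
  | cons a l ih =>
    rw [List.forall_mem_cons, ← ih]
    rfl

theorem EFml.holds_bigOr (v : Val M) (l : List (EFml L)) :
    (EFml.bigOr l).Holds v ↔ ∃ φ ∈ l, φ.Holds v := by
  induction l with
  | nil => simp [EFml.bigOr, EFml.Holds]
  | cons a l ih =>
    rw [List.exists_mem_cons_iff, ← ih]
    rfl

theorem Seq.holds_interp (v : Val M) (S : Seq L) : S.interp.Holds v ↔ S.Holds v := by
  simp [Seq.interp, Seq.Holds, EFml.Holds, EFml.holds_bigAnd, EFml.holds_bigOr]

theorem Seq.holds_atN (v : Val M) (S : Seq L) (w : NumExp) :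
    (S.atN w).Holds v ↔ S.Holds (v.setNum freeParam (w.eval v.num)) := by
  simp [Seq.atN, Seq.Holds, Fml.holds_nsubst]

theorem Seq.holds_subst (v : Val M) (S : Seq L) (σ : Subst L) :
    (S.subst σ).Holds v ↔ S.Holds (v.subst σ) := by
  simp [Seq.subst, Seq.Holds, Fml.holds_subst]

theorem Val.setNum_setNum (v : Val M) (p i j : ℕ) : (v.setNum p i).setNum p j = v.setNum p j := by
  simp [Val.setNum]

/-- Brings an arbitrary valuation with prescribed parameters, as supplied by `Seq.HoldsAt`, into the
form of the induction hypothesis in `Seq.valid_of_stepSound`. -/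
theorem Val.setNum_of_num_eq {v w : Val M} {p i : ℕ} (h : w.num = (v.setNum p i).num) :
    w.setNum p i = w := by
  cases w
  simp only [Val.setNum] at h ⊢
  rw [h, Function.update_idem]

theorem Seq.holds_atN_n (v : Val M) (S : Seq L) : (S.atN .n).Holds v ↔ S.Holds v := by
  rw [Seq.holds_atN]
  simp [Val.setNum, NumExp.n, NumExp.eval]

theorem Seq.holds_setNum_zero (v : Val M) (S : Seq L) :
    S.Holds (v.setNum freeParam 0) ↔ (S.atN .zero).Holds v :=
  (Seq.holds_atN v S .zero).symm

/-- Truth of a sequent for given values of the parameters and all values of the variables. -/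
def Seq.HoldsAt (M : Model L) (e : ℕ → ℕ) (S : Seq L) : Prop :=
  ∀ v : Val M, v.num = e → S.Holds v

/-- Validity of a sequent. -/
def Seq.Valid (E : EqTheory L) (S : Seq L) : Prop :=
  ∀ M : Model L, M.Satisfies E → ∀ e, S.HoldsAt M e

theorem Seq.Valid.holds {E : EqTheory L} {S : Seq L} (h : S.Valid E) (hM : M.Satisfies E)
    (v : Val M) : S.Holds v := h M hM v.num v rfl

theorem Seq.valid_interp_iff {E : EqTheory L} {S : Seq L} : S.interp.Valid E ↔ S.Valid E :=
  ⟨fun h M hM _ v _ => (Seq.holds_interp v S).1 (h M hM v),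
    fun h _ hM v => (Seq.holds_interp v S).2 (h.holds hM v)⟩

theorem Seq.Valid.allNum {E : EqTheory L} {S : Seq L} (h : S.Valid E) :
    (EFml.allNum S.interp).Valid E :=
  fun M hM _ _ => Seq.valid_interp_iff.2 h M hM _

/-! ### Soundness of LKE -/

theorem Seq.holdsAt_ax (e : ℕ → ℕ) (A : Fml L 0) : (Seq.ax A).HoldsAt M e :=
  fun _ _ h => ⟨A, by simp [Seq.ax], h A (by simp [Seq.ax])⟩

/-- Truth at a single valuation is not preserved by the eigenvariable rules, which use the premise
at a changed variable; the parameters can stay fixed. The binary rules have no eigenvariables, so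
`Rule2.holds` is pointwise. -/
theorem Rule1.holdsAt {E : EqTheory L} (hM : M.Satisfies E) {e : ℕ → ℕ} {T T' : Seq L}
    (h : Rule1 E T T') (hT : T.HoldsAt M e) : T'.HoldsAt M e := by
  intro v hv
  have hTv := hT v hv
  cases h with
  | allL A t Γ Δ =>
    simp only [Seq.Holds, Multiset.forall_mem_cons, Fml.holds_inst, Fml.Holds] at hTv ⊢
    exact fun h => hTv ⟨h.1 _, h.2⟩
  | exR A t Γ Δ =>
    simp only [Seq.Holds, Multiset.mem_cons, exists_eq_or_imp, Fml.holds_inst, Fml.Holds]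
      at hTv ⊢
    exact fun h => (hTv h).imp_left fun h => ⟨_, h⟩
  | allR A z Γ Δ hz =>
    intro hΓ
    by_contra hΔ
    simp only [Multiset.mem_cons, exists_eq_or_imp, not_or] at hΔ
    refine hΔ.1 fun d => ?_
    have hA : A.Avoids z := hz.2 A.all (Multiset.mem_cons_self _ _)
    -- Setting `z` to `d` keeps the parameters, so the premise still applies, and keeps the truth of
    -- all side formulas, since they avoid `z`.
    obtain ⟨B, hB, hBv⟩ := hT (v.setVar d z) (by simpa using hv)
      fun B hB => (Fml.holds_setVar v d z _ B (hz.1 B hB)).2 (hΓ B hB)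
    rcases Multiset.mem_cons.1 hB with rfl | hB
    · exact (Fml.holds_inst_eigen v d z A hA).1 hBv
    · exact absurd ⟨B, hB, (Fml.holds_setVar v d z _ B
        (hz.2 B (Multiset.mem_cons_of_mem hB))).1 hBv⟩ hΔ.2
  | exL A z Γ Δ hz =>
    intro hΓ
    obtain ⟨⟨d, hd⟩, hΓ⟩ := Multiset.forall_mem_cons.1 hΓ
    have hA : A.Avoids z := hz.1 A.ex (Multiset.mem_cons_self _ _)
    obtain ⟨B, hB, hBv⟩ := hT (v.setVar d z) (by simpa using hv)
      (Multiset.forall_mem_cons.2 ⟨(Fml.holds_inst_eigen v d z A hA).2 hd,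
        fun B hB => (Fml.holds_setVar v d z _ B
          (hz.1 B (Multiset.mem_cons_of_mem hB))).2 (hΓ B hB)⟩)
    exact ⟨B, hB, (Fml.holds_setVar v d z _ B (hz.2 B hB)).1 hBv⟩
  | eqL A A' Γ Δ h =>
    simpa only [Seq.Holds, Multiset.forall_mem_cons, h M hM v] using hTv
  | eqR A A' Γ Δ h =>
    simpa only [Seq.Holds, Multiset.mem_cons, exists_eq_or_imp, h M hM v] using hTv
  | _ =>
    simp only [Seq.Holds, Multiset.mem_cons, or_imp, forall_and, forall_eq, exists_eq_or_imp,
      Fml.Holds] at hTv ⊢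
    tauto

theorem Rule2.holds {v : Val M} {T₁ T₂ T' : Seq L} (h : Rule2 T₁ T₂ T') (h₁ : T₁.Holds v)
    (h₂ : T₂.Holds v) : T'.Holds v := by
  cases h <;>
  · simp only [Seq.Holds, Multiset.mem_cons, Multiset.mem_add, or_imp, forall_and, forall_eq,
      or_and_right, exists_or, exists_eq_left, Fml.Holds] at h₁ h₂ ⊢
    grind

theorem Rule1.valid {E : EqTheory L} {T T' : Seq L} (h : Rule1 E T T') (hT : T.Valid E) :
    T'.Valid E :=
  fun M hM e => h.holdsAt hM (hT M hM e)

theorem Rule2.valid {E : EqTheory L} {T₁ T₂ T' : Seq L} (h : Rule2 T₁ T₂ T')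
    (h₁ : T₁.Valid E) (h₂ : T₂.Valid E) : T'.Valid E :=
  fun M hM e v hv => h.holds (h₁ M hM e v hv) (h₂ M hM e v hv)

/-! ### Soundness of the inferences on groups -/

/-- The sequent of a basecase. -/
def Base.seq : Base L → Seq L
  | .unclosed π => π
  | .closed π _ => π

/-- `T` follows from the validity of `S` at the same values of the parameters, and is valid outright
unless the superscript `α` is `n + 1`. -/
def StepSound (E : EqTheory L) (S : Seq L) (α : NumExp) (T : Seq L) : Prop :=
  ∀ M : Model L, M.Satisfies E → ∀ e,
    (α = .succ .n → S.HoldsAt M e) → T.HoldsAt M e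

/-- The stepcase of the pair is sound relative to the schema recorded in the basecase. -/
def CPair.StepSound (E : EqTheory L) (p : CPair L) : Prop :=
  ∀ α T π S, p = ⟨.sq α T, .closed π S⟩ → SiLK.StepSound E S α T

/-- Soundness of a component pair. In the literal reading only the basecase matters. -/
def CPair.Sound (E : EqTheory L) (m : Mode) (p : CPair L) : Prop :=
  p.base.seq.Valid E ∧ (m = .tied → p.StepSound E)

/-- Soundness of a component group. -/
def Group.Sound (E : EqTheory L) (m : Mode) : Group L → Prop
  | .opened Γ => ∀ p ∈ Γ, p.Sound E m
  | .lke π => π.Valid E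
  | .sc S α => m = .tied → (S.atN .zero).Valid E ∧ (S.atN α).Valid E ∧
      (α = .succ .n → S.Valid E)

theorem CPair.sound_top {E : EqTheory L} {m : Mode} {β : Base L} :
    CPair.Sound E m ⟨.top, β⟩ ↔ β.seq.Valid E := by
  simp [CPair.Sound, CPair.StepSound]

theorem CPair.sound_sq {E : EqTheory L} {m : Mode} {α : NumExp} {T π S : Seq L} :
    CPair.Sound E m ⟨.sq α T, .closed π S⟩ ↔
      π.Valid E ∧ (m = .tied → SiLK.StepSound E S α T) := by
  refine and_congr Iff.rfl (imp_congr Iff.rfl ⟨fun h => h _ _ _ _ rfl, ?_⟩)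
  rintro h _ _ _ _ ⟨⟩
  exact h

theorem CPair.Sound.base {E : EqTheory L} {m : Mode} {p : CPair L} (h : p.Sound E m) :
    p.base.seq.Valid E := h.1

/-- The linked instance is valid outright, so the superscript `f` and the schema `S` of the calling
group can be arbitrary. The substitution only changes the valuation, and the closed group supplies
its instances at every valuation. -/
theorem stepSound_of_link {E : EqTheory L} {S S₁ T : Seq L} {α₁ f g h : NumExp} (σ : Subst L)
    (h₀ : (S₁.atN .zero).Valid E) (h₁ : (S₁.atN α₁).Valid E) (hT : S₁.atN α₁ = T.atN h)
    (hT₀ : S₁.atN .zero = T.atN .zero)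
    (hg : ∀ e : ℕ → ℕ, g.eval e = 0 ∨
      ∃ i : ℕ, g.eval e = h.eval (Function.update e freeParam i)) :
    StepSound E S f ((T.atN g).subst σ) := by
  intro M hM e _ v _
  rw [Seq.holds_subst, Seq.holds_atN]
  generalize v.subst σ = w
  rcases hg w.num with hg | ⟨i, hg⟩
  · rw [hg, Seq.holds_setNum_zero, ← hT₀]
    exact h₀.holds hM w
  -- Resetting `n` to `i` first makes `T[n \ h]` speak about `T` at the value of `h` at `i`, which
  -- is the value of `g`.
  · have := h₁.holds hM (w.setNum freeParam i)
    rw [hT, Seq.holds_atN, Val.setNum_setNum] at this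
    rw [hg]
    exact this

theorem GroupRule.sound {E : EqTheory L} {m : Mode} {C : Collection L} {Γ Γ' : Multiset (CPair L)}
    (h : GroupRule E m C Γ Γ') (hC : ∀ G ∈ C, G.Sound E m) (hΓ : ∀ p ∈ Γ, p.Sound E m) :
    ∀ p ∈ Γ', p.Sound E m := by
  cases h with
  | axR A Γ =>
    exact Multiset.forall_mem_cons.2
      ⟨CPair.sound_top.2 fun M _ e => Seq.holdsAt_ax e A, hΓ⟩
  | axL A α π S Γ =>
    simp only [Multiset.forall_mem_cons, CPair.sound_top, CPair.sound_sq] at hΓ ⊢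
    exact ⟨⟨hΓ.1, fun _ M _ e _ => Seq.holdsAt_ax e A⟩, hΓ.2⟩
  | contrR β Γ => exact (Multiset.forall_mem_cons.1 hΓ).2
  | contrL ν π S Γ => exact (Multiset.forall_mem_cons.1 hΓ).2
  | branch ν π S Γ =>
    exact Multiset.forall_mem_cons.2
      ⟨CPair.sound_top.2 (Multiset.forall_mem_cons.1 hΓ).1.base, hΓ⟩
  | closeBase π S Γ =>
    simp only [Multiset.forall_mem_cons, CPair.sound_top] at hΓ ⊢
    exact hΓ
  | step1 α T T' π S Γ h =>
    simp only [Multiset.forall_mem_cons, CPair.sound_sq] at hΓ ⊢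
    exact ⟨⟨hΓ.1.1, fun hm M hM e hS => h.holdsAt hM (hΓ.1.2 hm M hM e hS)⟩, hΓ.2⟩
  | step2 α T₁ T₂ T' π S Γ h =>
    simp only [Multiset.forall_mem_cons, CPair.sound_sq] at hΓ ⊢
    exact ⟨⟨hΓ.1.1, fun hm M hM e hS v hv =>
      h.holds (hΓ.1.2 hm M hM e hS v hv) (hΓ.2.1.2 hm M hM e hS v hv)⟩, hΓ.2.2⟩
  | base1 π π' Γ h =>
    simp only [Multiset.forall_mem_cons, CPair.sound_top] at hΓ ⊢
    exact ⟨h.valid hΓ.1, hΓ.2⟩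
  | base2 π₁ π₂ π' Γ h =>
    simp only [Multiset.forall_mem_cons, CPair.sound_top] at hΓ ⊢
    exact ⟨h.valid hΓ.1 hΓ.2.1, hΓ.2.2⟩
  | loop π S S' Γ σ hπ hm =>
    simp only [Multiset.forall_mem_cons, CPair.sound_top, CPair.sound_sq] at hΓ ⊢
    refine ⟨⟨hΓ.1, fun hm' M _ e hS v hv => ?_⟩, hΓ.2⟩
    rw [Seq.holds_subst, Seq.holds_atN_n, hm hm']
    -- The superscript is `n + 1`, so the schema may be assumed; `v.subst σ` has the parameters of
    -- `v`.
    exact hS rfl _ hv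
  | link π S Γ S₁ α₁ T f g h σ hctx hT hm =>
    simp only [Multiset.forall_mem_cons, CPair.sound_top, CPair.sound_sq] at hΓ ⊢
    refine ⟨⟨hΓ.1, fun hm' => ?_⟩, hΓ.2⟩
    obtain ⟨h₀, h₁, -⟩ := hC _ hctx hm'
    exact stepSound_of_link σ h₀ h₁ hT (hm hm').1 (hm hm').2

/-! ### Induction on the free parameter and closure of groups -/

/-- Induction on the value of the free parameter. -/
theorem Seq.holds_of_step {S : Seq L} (v : Val M)
    (h₀ : S.Holds (v.setNum freeParam 0))
    (h₁ : ∀ i, S.Holds (v.setNum freeParam i) → S.Holds (v.setNum freeParam (i + 1))) (i : ℕ) :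
    S.Holds (v.setNum freeParam i) := by
  induction i with
  | zero => exact h₀
  | succ i ih => exact h₁ i ih

/-- Unlike in `Seq.holds_of_step`, the valuation must vary in the induction: the step from `i` to `i
+ 1` may use the schema at `i` for other values of the variables. -/
theorem Seq.valid_of_stepSound {E : EqTheory L} {S : Seq L} (h₀ : (S.atN .zero).Valid E)
    (h : StepSound E S (.succ .n) (S.atN (.succ .n))) : S.Valid E := by
  have key : ∀ M : Model L, M.Satisfies E → ∀ (i : ℕ) (v : Val M),
      S.Holds (v.setNum freeParam i) := by
    intro M hM i
    induction i with
    | zero => exact fun v => (Seq.holds_setNum_zero v S).2 (h₀.holds hM v)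
    | succ i ih =>
      intro v
      have := h M hM (v.setNum freeParam i).num
        (fun _ w hw => Val.setNum_of_num_eq hw ▸ ih w) (v.setNum freeParam i) rfl
      rw [Seq.holds_atN, Val.setNum_setNum] at this
      simpa [NumExp.eval, NumExp.n, Val.setNum] using this
  intro M hM e v _
  simpa [Val.setNum] using key M hM (v.num freeParam) v

theorem CloseRule.sound {E : EqTheory L} {m : Mode} {Γ : Multiset (CPair L)} {G : Group L}
    (h : CloseRule m Γ G) (hΓ : ∀ p ∈ Γ, p.Sound E m) : G.Sound E m := by
  cases h with
  | closeLKE π S => exact CPair.sound_top.1 (hΓ _ (Multiset.mem_singleton_self _))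
  | closeSC α T π S S' hT hπ hm =>
    intro hm'
    obtain ⟨h₀, h₁⟩ := CPair.sound_sq.1 (hΓ _ (Multiset.mem_singleton_self _))
    obtain rfl := hm hm'
    have h₁ := h₁ hm'
    subst hT hπ
    -- The distinction is syntactic. Only the superscript `n + 1` leaves an assumption to discharge
    -- by induction; otherwise the stepcase is already valid.
    by_cases hα : α = .succ .n
    · subst hα
      have h := Seq.valid_of_stepSound h₀ h₁
      exact ⟨h₀, fun M hM e v _ => (Seq.holds_atN v _ _).2 (h.holds hM _), fun _ => h⟩
    · exact ⟨h₀, fun M hM e => h₁ M hM e fun h => absurd h hα, fun h => absurd h hα⟩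

/-! ### Invariants of derivations -/

theorem Deriv.sound {E : EqTheory L} {m : Mode} {C : Collection L} {ℓ : Option (Group L)}
    (h : Deriv E m C ℓ) : ∀ G ∈ C, G.Sound E m := by
  induction h with
  | start => simp
  | newGroup A C ℓ _ ih =>
    refine (Finset.forall_mem_insert _ _ _).2 ⟨fun p hp => ?_, ih⟩
    rw [Multiset.mem_singleton.1 hp]
    exact CPair.sound_top.2 fun M _ e => Seq.holdsAt_ax e A
  | groupRule Γ Γ' C ℓ h _ ih =>
    obtain ⟨hΓ, hC⟩ := (Finset.forall_mem_insert _ _ _).1 ih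
    exact (Finset.forall_mem_insert _ _ _).2 ⟨h.sound hC hΓ, hC⟩
  | close Γ G C ℓ h _ ih =>
    obtain ⟨hΓ, hC⟩ := (Finset.forall_mem_insert _ _ _).1 ih
    exact (Finset.forall_mem_insert _ _ _).2 ⟨h.sound hΓ, hC⟩

/-- Inferences replace only open groups, so a group stays in the collection once it is closed.
Closedness is part of the claim because it separates the leading group from the one being replaced.
-/
theorem Deriv.leading_mem {E : EqTheory L} {m : Mode} {C : Collection L} {ℓ : Option (Group L)}
    (h : Deriv E m C ℓ) : ∀ G, ℓ = some G → G ∈ C ∧ G.IsClosed := by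
  induction h with
  | start => rintro G ⟨⟩
  | newGroup A C ℓ _ ih =>
    exact fun G hG => (ih G hG).imp_left (Finset.mem_insert_of_mem ·)
  | groupRule Γ Γ' C ℓ _ _ ih =>
    intro G hG
    obtain ⟨hmem, hcl⟩ := ih G hG
    rcases Finset.mem_insert.1 hmem with rfl | hmem
    · exact hcl.elim
    · exact ⟨Finset.mem_insert_of_mem hmem, hcl⟩
  | close Γ G C ℓ h _ _ =>
    rintro _ ⟨⟩
    exact ⟨Finset.mem_insert_self _ _, by cases h <;> trivial⟩

/-- The evaluation of a collection with the schema of a member as leading component holds by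
induction on the free parameter. -/
theorem evalSiLK_sc_valid (E : EqTheory L) {C : Collection L} {S : Seq L} {α : NumExp}
    (h : Group.sc S α ∈ C) : (evalSiLK C (.sc S α)).Valid E := by
  rintro M - v ⟨hbase, hstep⟩ i
  -- Of all conjuncts, only those of the leading group itself are needed.
  have h₀ := (EFml.holds_bigAnd v _).1 hbase _
    (List.mem_map_of_mem (Finset.mem_toList.2 h))
  have h₁ := fun i => (EFml.holds_bigAnd _ _).1 (hstep i) _
    (List.mem_map_of_mem (Finset.mem_toList.2 h))
  rw [Seq.holds_interp, Seq.holds_atN_n]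
  refine Seq.holds_of_step v ?_ (fun i hi => ?_) i
  · exact (Seq.holds_setNum_zero v S).2 ((Seq.holds_interp v _).1 h₀)
  · have := h₁ i ((Seq.holds_interp _ _).2 ((Seq.holds_atN_n _ _).2 hi))
    rw [Seq.holds_interp] at this
    have := (Seq.holds_atN (v.setNum freeParam i) S _).1 this
    rw [Val.setNum_setNum] at this
    simpa [NumExp.eval, NumExp.n, Val.setNum] using this

end SiLK

theorem mainTheorem1 (L : SiLK.Signature.{u}) (E : SiLK.EqTheory L) (C : SiLK.Collection L)
    (G₀ : SiLK.Group L) :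
    (SiLK.Provable E .literal C G₀ → (SiLK.evalSiLK C G₀).Valid E) ∧
    (SiLK.Provable E .tied C G₀ →
      G₀ ∈ C ∧
      (∀ π, SiLK.Group.lke π ∈ C → π.interp.Valid E) ∧
      (∀ S α, SiLK.Group.sc S α ∈ C →
        (S.atN .zero).interp.Valid E ∧ (SiLK.EFml.allNum (S.atN α).interp).Valid E ∧
        (α = .succ .n → (SiLK.EFml.allNum (S.atN .n).interp).Valid E))) := by
  refine ⟨fun ⟨_, hd⟩ => ?_, fun ⟨_, hd⟩ => ⟨(hd.leading_mem _ rfl).1, fun π hπ => ?_,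
    fun S α hS => ?_⟩⟩
  · obtain ⟨hmem, hcl⟩ := hd.leading_mem _ rfl
    cases G₀ with
    | opened Γ => exact hcl.elim
    | lke π => exact SiLK.Seq.valid_interp_iff.2 (hd.sound _ hmem)
    | sc S α => exact SiLK.evalSiLK_sc_valid E hmem
  · exact SiLK.Seq.valid_interp_iff.2 (hd.sound _ hπ)
  · obtain ⟨h₀, hα, hn⟩ := hd.sound _ hS rfl
    refine ⟨SiLK.Seq.valid_interp_iff.2 h₀, hα.allNum, fun h => SiLK.Seq.Valid.allNum ?_⟩
    exact fun M hM e v _ => (SiLK.Seq.holds_atN_n v S).2 ((hn h).holds hM v)
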